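/- Let $d\ge 0$, let $A\subseteq\mathbb R^d$ be locally finite (every bounded set contains only finitely many points of $A$), and write $B(R)$ for the closed ball of radius $R$ centered at the origin. The Voronoi domain of $a\in A$ is the set of points $x\in\mathbb{R}^d$ with $|x-a|\le|x-b|$ for all $b\in A$. A Delaunay cell of $A$ is a polytope $\gamma=\operatorname{conv}S$, where $S\ne\emptyset$ is the set of all points of $A$ whose Voronoi domains contain some common point $x\in\mathbb R^d$; its dual Voronoi cell $\gamma^*$ is the intersection of the Voronoi domains of the points of $S$. For $0\le p\le d$ let $\mathrm{Gr}(p,d)$ be the Grassmannian of $p$-dimensional linear subspaces of $\mathbb R^d$, with its rotation-invariant probability measure, and let $\mathbb R^d\times \mathrm{Gr}(p,d)$ carry the product of Lebesgue measure with it. The $p$-tile of a $p$-dimensional Delaunay cell $\gamma$ is the set $J(\gamma,\gamma^*)$ of all $(x,L)\in\mathbb R^d\times\mathrm{Gr}(p,d)$ such that $x$ lies in the orthogonal projection of $\gamma$ onto $L+x$ and $(L+x)\cap\gamma^*\neq\emptyset$. It is a boundary tile of a set $\Omega\subseteq\mathbb{R}^d$ if its projection to $\mathbb R^d$ contains a point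 inside and a point outside $\Omega$. The set $A$ has the mixed regularity property if, for every $0\le p\le d$, the sum of the measures of the boundary $p$-tiles of $B(R)$ is $o(R^d)$ as $R\to\infty$. Then $A$ has the mixed regularity property if one of the following holds: (1) $\operatorname{conv}A=\mathbb R^d$, and the radii of all circumspheres of $d$-dimensional Delaunay cells of $A$ are bounded. (2) There is $R_0$ such that every ball in $\mathbb R^d$ of radius greater than $R_0$ contains a point of $A$. (3) There is a non-negative function $g$ with $g(R)=o(R)$ as $R\to\infty$ such that, for all sufficiently large $R$, every closed ball of radius $g(R)$ that intersects $B(R)$ contains at least one point of $A$. -/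

import Mathlib

noncomputable section

open MeasureTheory Filter Topology Set

namespace VoronoiScape

/-- Euclidean `d`-space. -/
abbrev E (d : ℕ) : Type := EuclideanSpace ℝ (Fin d)

/-! ## The Grassmannian with its uniform probability measure -/

/-- The linear Grassmannian: the `p`-planes through the origin of `d`-space. -/
def Gr (d p : ℕ) : Type := {L : Submodule ℝ (E d) // Module.finrank ℝ L = p}

namespace Gr

/-- A `p`-plane is identified with the orthogonal projection onto it, an operator. -/
def proj {d p : ℕ} (L : Gr d p) : E d →L[ℝ] E d := L.1.starProjection

/-- The usual topology of the Grassmannian, induced by `L ↦ proj L` and the operator norm. -/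
instance (d p : ℕ) : TopologicalSpace (Gr d p) := TopologicalSpace.induced Gr.proj inferInstance

instance (d p : ℕ) : MeasurableSpace (Gr d p) := borel (Gr d p)

instance (d p : ℕ) : BorelSpace (Gr d p) := ⟨rfl⟩

end Gr

/-- The orthogonal group of `d`-space. -/
abbrev OrthGroup (d : ℕ) : Type := unitary (E d →L[ℝ] E d)

instance (d : ℕ) : ContinuousStar (E d →L[ℝ] E d) :=
  ⟨(ContinuousLinearMap.adjoint (𝕜 := ℝ) (E := E d) (F := E d)).continuous⟩

instance (d : ℕ) : CompactSpace (OrthGroup d) := by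
  have : ProperSpace (E d →L[ℝ] E d) := FiniteDimensional.proper ℝ _
  refine isCompact_iff_compactSpace.1 ?_
  refine Metric.isCompact_of_isClosed_isBounded isClosed_unitary ?_
  refine (Metric.isBounded_closedBall (x := (0 : E d →L[ℝ] E d)) (r := 1)).subset ?_
  intro u hu
  rw [mem_closedBall_zero_iff]
  refine ContinuousLinearMap.opNorm_le_bound _ zero_le_one fun x => ?_
  rw [one_mul]
  exact ((Unitary.linearIsometryEquiv (⟨u, hu⟩ : OrthGroup d)).norm_map x).le

/-- The normalized Haar measure of the orthogonal group. -/
def orthHaar (d : ℕ) : Measure (OrthGroup d) := Measure.haarMeasure ⊤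

instance (d : ℕ) : IsProbabilityMeasure (orthHaar d) :=
  ⟨Measure.haarMeasure_self (K₀ := (⊤ : TopologicalSpace.PositiveCompacts (OrthGroup d)))⟩

/-- The image `u L` of the plane `L` under the orthogonal map `u`. -/
def rotate {d p : ℕ} (u : OrthGroup d) (L : Gr d p) : Gr d p :=
  ⟨L.1.map (Unitary.linearIsometryEquiv u).toLinearEquiv.toLinearMap,
    ((Unitary.linearIsometryEquiv u).toLinearEquiv.finrank_map_eq L.1).trans L.2⟩

/-- The plane spanned by the first `p` coordinate axes. -/
def coordPlane {d p : ℕ} (hp : p ≤ d) : Gr d p :=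
  ⟨Submodule.span ℝ (Set.range fun i : Fin p => EuclideanSpace.basisFun (Fin d) ℝ (Fin.castLE hp i)),
    by
      have h : LinearIndependent ℝ
          (fun i : Fin p => EuclideanSpace.basisFun (Fin d) ℝ (Fin.castLE hp i)) :=
        (EuclideanSpace.basisFun (Fin d) ℝ).orthonormal.linearIndependent.comp _
          (Fin.castLE_injective hp)
      simpa using finrank_span_eq_card h⟩

theorem proj_rotate {d p : ℕ} (u : OrthGroup d) (L : Gr d p) :
    (rotate u L).proj = (u : E d →L[ℝ] E d) * L.proj * star (u : E d →L[ℝ] E d) := by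
  ext1 x
  have h := Submodule.starProjection_map_apply (Unitary.linearIsometryEquiv u) L.1 x
  exact h

theorem continuous_rotate {d p : ℕ} (L : Gr d p) :
    Continuous fun u : OrthGroup d => rotate u L := by
  refine continuous_induced_rng.2 ?_
  have h : (Gr.proj ∘ fun u : OrthGroup d => rotate u L) =
      fun u : OrthGroup d => (u : E d →L[ℝ] E d) * L.proj * star (u : E d →L[ℝ] E d) :=
    funext fun u => proj_rotate u L
  rw [h]
  fun_prop

/-- The uniform (rotation invariant) probability measure on the Grassmannian: the law of the
image of a fixed `p`-plane under a uniformly random orthogonal map. -/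
def uniformGr {d p : ℕ} (hp : p ≤ d) : Measure (Gr d p) :=
  (orthHaar d).map fun u => rotate u (coordPlane hp)

instance {d p : ℕ} (hp : p ≤ d) : IsProbabilityMeasure (uniformGr hp) :=
  Measure.isProbabilityMeasure_map (continuous_rotate _).measurable.aemeasurable

/-! ## Voronoi tessellation and Delaunay mosaic -/

/-- `A` is locally finite: bounded sets contain only finitely many points of `A`. -/
def LocallyFiniteSet {d : ℕ} (A : Set (E d)) : Prop :=
  ∀ B : Set (E d), Bornology.IsBounded B → (A ∩ B).Finite

/-- The Voronoi domain of `a`: the points that have no point of `A` closer than `a`. -/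
def voronoiDomain {d : ℕ} (A : Set (E d)) (a : E d) : Set (E d) :=
  {x | ∀ b ∈ A, dist x a ≤ dist x b}

/-- The points of `A` whose Voronoi domains contain `x`. -/
def generators {d : ℕ} (A : Set (E d)) (x : E d) : Set (E d) :=
  {a ∈ A | x ∈ voronoiDomain A a}

/-- `S` generates a cell of the Delaunay mosaic (equivalently of the Voronoi tessellation):
for some point `x`, it is the non-empty set of all points of `A` whose Voronoi domains
contain `x`. Equivalently, the points of `A` on some sphere with no point of `A` inside. -/
def IsDelaunay {d : ℕ} (A S : Set (E d)) : Prop :=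
  S.Nonempty ∧ ∃ x, S = generators A x

/-- The Delaunay cell `γ` with vertex set `S`. -/
def delaunayCell {d : ℕ} (S : Set (E d)) : Set (E d) := convexHull ℝ S

/-- The dual Voronoi cell `γ*`: the intersection of the Voronoi domains of the points in `S`. -/
def voronoiCell {d : ℕ} (A S : Set (E d)) : Set (E d) := ⋂ a ∈ S, voronoiDomain A a

/-- The dimension of the Delaunay cell with vertex set `S`. -/
def cellDim {d : ℕ} (S : Set (E d)) : ℕ := Module.finrank ℝ (vectorSpan ℝ S)

/-! ## Tiles and mixed regularity -/

/-- The orthogonal projection of `u` onto the affine plane `L + x`. -/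
def projAffine {d p : ℕ} (L : Gr d p) (x u : E d) : E d := x + L.proj (u - x)

/-- The tile of a pair of cells: all pairs `(x, L)` such that `x` lies in the projection of
`γ` onto `L + x`, and `L + x` meets `γ'`. -/
def tile {d : ℕ} (p : ℕ) (γ γ' : Set (E d)) : Set (E d × Gr d p) :=
  {q | q.1 ∈ projAffine q.2 q.1 '' γ ∧ ({y | y - q.1 ∈ q.2.1} ∩ γ').Nonempty}

/-- The `p`-tile of the Delaunay cell with vertex set `S` and its dual Voronoi cell. -/
def delaunayTile {d : ℕ} (p : ℕ) (A S : Set (E d)) : Set (E d × Gr d p) :=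
  tile p (delaunayCell S) (voronoiCell A S)

/-- A boundary tile of `Ω`: its projection to `d`-space has a point inside and a point
outside `Ω`. -/
def IsBoundaryTile {d p : ℕ} (J : Set (E d × Gr d p)) (Ω : Set (E d)) : Prop :=
  (∃ q ∈ J, q.1 ∈ Ω) ∧ ∃ q ∈ J, q.1 ∉ Ω

/-- The (vertex sets of) `p`-dimensional Delaunay cells whose tiles are boundary tiles of the
ball of radius `R` centered at the origin. -/
def boundaryCells {d : ℕ} (p : ℕ) (A : Set (E d)) (R : ℝ) : Set (Set (E d)) :=
  {S | IsDelaunay A S ∧ cellDim S = p ∧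
    IsBoundaryTile (delaunayTile p A S) (Metric.closedBall 0 R)}

/-- The total measure of the boundary `p`-tiles of the ball of radius `R` centered at the origin,
with respect to the product of Lebesgue measure and the uniform probability measure. -/
def boundaryMeasure {d p : ℕ} (hp : p ≤ d) (A : Set (E d)) (R : ℝ) : ENNReal :=
  ∑' S : boundaryCells p A R,
    ((volume : Measure (E d)).prod (uniformGr hp)) (delaunayTile p A S.1)

/-- Mixed regularity: for every `p`, the total measure of the boundary `p`-tiles of the ball of
radius `R` centered at the origin is finite for large `R`, and is `o(R ^ d)`. -/
def MixedRegularity {d : ℕ} (A : Set (E d)) : Prop :=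
  ∀ (p : ℕ) (hp : p ≤ d), ∀ ε : ℝ, 0 < ε →
    ∀ᶠ R : ℝ in atTop, boundaryMeasure hp A R ≤ ENNReal.ofReal (ε * R ^ d)

/-! ## The three conditions -/

/-- The radii of the circumspheres of the top-dimensional Delaunay cells are bounded. -/
def BoundedCircumradii {d : ℕ} (A : Set (E d)) : Prop :=
  ∃ C : ℝ, ∀ S, IsDelaunay A S → cellDim S = d →
    ∀ (c : E d) (r : ℝ), (∀ a ∈ S, dist a c = r) → r ≤ C

/-- Every ball of radius greater than some `R₀` contains a point of `A`. -/
def UniformlyDense {d : ℕ} (A : Set (E d)) : Prop :=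
  ∃ R₀ : ℝ, ∀ r : ℝ, R₀ < r → 0 < r → ∀ c : E d, (Metric.closedBall c r ∩ A).Nonempty

/-- For some non-negative `g(R) = o(R)` and all large `R`, every ball of radius `g(R)` that meets
the ball of radius `R` centered at the origin contains a point of `A`. -/
def SublinearlyDense {d : ℕ} (A : Set (E d)) : Prop :=
  ∃ g : ℝ → ℝ, g =o[atTop] (fun R : ℝ => R) ∧
    ∀ᶠ R : ℝ in atTop, 0 ≤ g R ∧
      ∀ c : E d, (Metric.closedBall c (g R) ∩ Metric.closedBall 0 R).Nonempty →
        (Metric.closedBall c (g R) ∩ A).Nonempty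

end VoronoiScape

end

noncomputable section

open MeasureTheory Filter Topology Set

namespace VoronoiScape

variable {d p : ℕ} {A S : Set (E d)}

open scoped RealInnerProductSpace

/-! ## Voronoi domains and Delaunay cells -/

/-! The conditions form a chain (1) ⇒ (2) ⇒ (3), and (3) confines boundary tiles to a thin spherical
shell.

For (1) ⇒ (2), `convexHull ℝ A = univ` makes Voronoi domains bounded. A point of the domain of `a`
farthest from `a` generates a full-dimensional Delaunay cell, so its distance to `a` is a bounded
circumradius. Hence every point of space is within that bound of `A`.

Under (3), write a tile point `(x, L)` with `u ∈ γ`, `y ∈ γ*`, `u - x ⊥ L` and `y - x ∈ L`. By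
Pythagoras `x` is no farther from `u` or `y` than `u` is from `y`, and `|u - y|` is at most the
radius of the empty ball about `y`. Empty balls reaching near `B(R)` have radius at most `G = g (4R)
= o(R)`, so boundary tiles lie over the shell between radii `R - 6G` and `R + 6G`
(`boundaryTile_subset`).

Distinct tiles overlap in measure zero (`aedisjoint_tile`), and the Grassmannian has measure one.
The total measure is therefore at most the volume of the shell, which is `o(R ^ d)`. -/

theorem dist_le_dist_iff (x a b : E d) :
    dist x a ≤ dist x b ↔ 2 * ⟪b - a, x⟫ ≤ ‖b‖ ^ 2 - ‖a‖ ^ 2 := by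
  rw [dist_eq_norm, dist_eq_norm, ← sq_le_sq₀ (norm_nonneg _) (norm_nonneg _),
    norm_sub_sq_real, norm_sub_sq_real, inner_sub_left, real_inner_comm x b, real_inner_comm x a]
  constructor <;> intro h <;> linarith

theorem dist_lt_dist_iff (x a b : E d) :
    dist x a < dist x b ↔ 2 * ⟪b - a, x⟫ < ‖b‖ ^ 2 - ‖a‖ ^ 2 := by
  rw [← not_le, ← not_le, not_iff_not, dist_le_dist_iff, ← neg_sub a b, inner_neg_left]
  constructor <;> intro h <;> linarith

theorem voronoiDomain_eq_iInter (A : Set (E d)) (a : E d) :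
    voronoiDomain A a = ⋂ b ∈ A, {x | ⟪b - a, x⟫ ≤ (‖b‖ ^ 2 - ‖a‖ ^ 2) / 2} := by
  ext x
  simp only [voronoiDomain, mem_ofPred_eq, mem_iInter]
  refine forall₂_congr fun b _ => ?_
  rw [dist_le_dist_iff, le_div_iff₀ two_pos, mul_comm]

theorem convex_voronoiDomain (A : Set (E d)) (a : E d) : Convex ℝ (voronoiDomain A a) := by
  rw [voronoiDomain_eq_iInter]
  exact convex_iInter₂ fun b _ => convex_halfSpace_le (innerSL ℝ (b - a)).toLinearMap.isLinear _

theorem isClosed_voronoiDomain (A : Set (E d)) (a : E d) : IsClosed (voronoiDomain A a) := by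
  rw [voronoiDomain_eq_iInter]
  exact isClosed_biInter fun b _ => isClosed_le (by fun_prop) continuous_const

theorem convex_voronoiCell (A S : Set (E d)) : Convex ℝ (voronoiCell A S) :=
  convex_iInter₂ fun a _ => convex_voronoiDomain A a

theorem isClosed_voronoiCell (A S : Set (E d)) : IsClosed (voronoiCell A S) :=
  isClosed_biInter fun a _ => isClosed_voronoiDomain A a

theorem generators_subset (A : Set (E d)) (x : E d) : generators A x ⊆ A := fun _ h => h.1

theorem mem_voronoiCell_generators (A : Set (E d)) (x : E d) :
    x ∈ voronoiCell A (generators A x) := mem_iInter₂.2 fun _ h => h.2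

theorem dist_le_of_mem_voronoiCell {a b y : E d} (hy : y ∈ voronoiCell A S) (ha : a ∈ S)
    (hb : b ∈ A) : dist y a ≤ dist y b := mem_iInter₂.1 hy a ha b hb

theorem subset_generators (hS : S ⊆ A) {y : E d} (hy : y ∈ voronoiCell A S) :
    S ⊆ generators A y := fun a ha => ⟨hS ha, mem_iInter₂.1 hy a ha⟩

theorem dist_lt_of_notMem_generators {a b x : E d} (ha : a ∈ generators A x) (hb : b ∈ A)
    (hb' : b ∉ generators A x) : dist x a < dist x b := by
  by_contra! h
  exact hb' ⟨hb, fun e he => h.trans (ha.2 e he)⟩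

theorem IsDelaunay.subset (hS : IsDelaunay A S) : S ⊆ A := by
  obtain ⟨-, x, rfl⟩ := hS
  exact generators_subset A x

theorem IsDelaunay.finite (hA : LocallyFiniteSet A) (hS : IsDelaunay A S) : S.Finite := by
  obtain ⟨⟨a, ha⟩, x, rfl⟩ := hS
  refine (hA _ (Metric.isBounded_closedBall (x := x) (r := dist x a))).subset fun b hb => ?_
  exact ⟨hb.1, by rw [Metric.mem_closedBall, dist_comm]; exact hb.2 a ha.1⟩

/-- Every point in the half-open segment from a point of a Voronoi cell to a point whose set of
generators spans this cell has the same generators. -/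
theorem generators_lineMap {c y : E d} (hne : (generators A c).Nonempty)
    (hy : y ∈ voronoiCell A (generators A c)) {s t : ℝ} (hs : 0 < s) (ht : 0 ≤ t)
    (hst : t + s = 1) : generators A (t • y + s • c) = generators A c := by
  have hmem : t • y + s • c ∈ voronoiCell A (generators A c) :=
    convex_voronoiCell A _ hy (mem_voronoiCell_generators A c) ht hs.le hst
  refine Subset.antisymm (fun b hb => ?_) (subset_generators (generators_subset A c) hmem)
  by_contra hbc
  obtain ⟨a, ha⟩ := hne
  have h1 := (dist_lt_dist_iff _ _ _).1 (dist_lt_of_notMem_generators ha hb.1 hbc)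
  have h2 := (dist_le_dist_iff _ _ _).1 (dist_le_of_mem_voronoiCell hy ha hb.1)
  refine absurd (hb.2 a ha.1) (not_le.2 ((dist_lt_dist_iff _ _ _).2 ?_))
  rw [inner_add_right, real_inner_smul_right, real_inner_smul_right]
  have hs1 : s = 1 - t := by linarith
  -- The inequality is strict at `c`, which has positive weight, and weak at `y`.
  nlinarith [mul_lt_mul_of_pos_left h1 hs, mul_le_mul_of_nonneg_left h2 ht]

theorem dist_le_of_mem_delaunayCell {y u a : E d} (hy : y ∈ voronoiCell A S)
    (hu : u ∈ delaunayCell S) (ha : a ∈ A) : dist u y ≤ dist y a := by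
  have h : delaunayCell S ⊆ Metric.closedBall y (dist y a) := by
    refine convexHull_min (fun b hb => ?_) (convex_closedBall _ _)
    rw [Metric.mem_closedBall, dist_comm]
    exact dist_le_of_mem_voronoiCell hy hb ha
  exact h hu

/-! ## Fibres of tiles -/

/-- The sum of a set and a submodule, as a union of cosets. -/
def thicken (C : Set (E d)) (M : Submodule ℝ (E d)) : Set (E d) := {x | ∃ u ∈ C, u - x ∈ M}

theorem convex_thicken {C : Set (E d)} (hC : Convex ℝ C) (M : Submodule ℝ (E d)) :
    Convex ℝ (thicken C M) := by
  rintro x ⟨u, hu, hux⟩ y ⟨v, hv, hvy⟩ s t hs ht hst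
  refine ⟨s • u + t • v, hC hu hv hs ht hst, ?_⟩
  have := M.add_mem (M.smul_mem s hux) (M.smul_mem t hvy)
  convert this using 1
  module

/-- For fixed `L` this exhibits the fibre of a tile of convex cells as an intersection of two convex
sets, whose frontiers are null. -/
theorem mem_tile_iff {γ γ' : Set (E d)} {x : E d} {L : Gr d p} :
    (x, L) ∈ tile p γ γ' ↔ x ∈ thicken γ L.1ᗮ ∧ x ∈ thicken γ' L.1 := by
  refine and_congr ?_ ?_
  · refine exists_congr fun u => and_congr Iff.rfl ?_
    rw [← Submodule.starProjection_apply_eq_zero_iff]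
    exact add_eq_left
  · exact ⟨fun ⟨y, hy, hy'⟩ => ⟨y, hy', hy⟩, fun ⟨y, hy, hy'⟩ => ⟨y, hy', hy⟩⟩

/-- Push `x` slightly away from `c`. The coset there still meets the cell, and pulling the meeting
point back towards `c` lands in `x + M` with positive weight on `c`, so the generators are those of
`c`. -/
theorem exists_generators_eq_of_mem_interior {c x : E d} {M : Submodule ℝ (E d)}
    (hne : (generators A c).Nonempty)
    (hx : x ∈ interior (thicken (voronoiCell A (generators A c)) M)) :
    ∃ y, y - x ∈ M ∧ generators A y = generators A c := by
  have hcont : Continuous fun t : ℝ => x + t • (x - c) := by fun_prop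
  have h0 : ∀ᶠ t : ℝ in 𝓝 0, x + t • (x - c) ∈ thicken (voronoiCell A (generators A c)) M := by
    refine hcont.continuousAt.eventually ?_
    simp only [zero_smul, add_zero]
    exact mem_interior_iff_mem_nhds.1 hx
  obtain ⟨t, ⟨y, hy, hyx⟩, ht⟩ :=
    ((h0.filter_mono nhdsWithin_le_nhds).and (self_mem_nhdsWithin (s := Ioi 0))).exists
  have ht0 : 0 < t := ht
  refine ⟨(1 / (1 + t)) • y + (t / (1 + t)) • c, ?_,
    generators_lineMap hne hy (by positivity) (by positivity) (by field_simp)⟩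
  have := M.smul_mem (1 / (1 + t)) hyx
  convert this using 1
  match_scalars <;> field_simp

/-- The bilinear form pairing differences of dual points is monotone. -/
theorem inner_sub_nonneg_of_mem_generators {a b y y' : E d} (ha : a ∈ generators A y)
    (hb : b ∈ generators A y') : 0 ≤ ⟪y - y', a - b⟫ := by
  have h1 := (dist_le_dist_iff _ _ _).1 (ha.2 b hb.1)
  have h2 := (dist_le_dist_iff _ _ _).1 (hb.2 a ha.1)
  rw [inner_sub_left] at h1 h2
  rw [inner_sub_left, inner_sub_right, inner_sub_right, real_inner_comm a y, real_inner_comm b y,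
    real_inner_comm a y', real_inner_comm b y']
  linarith

theorem le_inner_of_mem_convexHull {v u : E d} {r : ℝ} (h : ∀ a ∈ S, r ≤ ⟪v, a⟫)
    (hu : u ∈ convexHull ℝ S) : r ≤ ⟪v, u⟫ :=
  convexHull_min (t := {u | r ≤ ⟪v, u⟫}) h
    (convex_halfSpace_ge (innerSL ℝ v).toLinearMap.isLinear r) hu

theorem inner_le_of_mem_convexHull {v u : E d} {r : ℝ} (h : ∀ a ∈ S, ⟪v, a⟫ ≤ r)
    (hu : u ∈ convexHull ℝ S) : ⟪v, u⟫ ≤ r :=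
  convexHull_min (t := {u | ⟪v, u⟫ ≤ r}) h
    (convex_halfSpace_le (innerSL ℝ v).toLinearMap.isLinear r) hu

/-- Two different Delaunay cells cannot both claim a point generically. -/
theorem eq_of_mem_interior {S' : Set (E d)} (hS : IsDelaunay A S) (hS' : IsDelaunay A S')
    {x : E d} {L : Submodule ℝ (E d)}
    (hx : x ∈ interior (thicken (delaunayCell S) Lᗮ))
    (hxv : x ∈ interior (thicken (voronoiCell A S) L))
    (hx' : x ∈ thicken (delaunayCell S') Lᗮ)
    (hxv' : x ∈ interior (thicken (voronoiCell A S') L)) : S = S' := by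
  obtain ⟨hne, c, rfl⟩ := hS
  obtain ⟨hne', c', rfl⟩ := hS'
  obtain ⟨y, hyx, hy⟩ := exists_generators_eq_of_mem_interior hne hxv
  obtain ⟨y', hyx', hy'⟩ := exists_generators_eq_of_mem_interior hne' hxv'
  obtain ⟨u', hu', hux'⟩ := hx'
  have hyy : y - y' ∈ L := by simpa using L.sub_mem hyx hyx'
  have hconst : ∀ u z : E d, u - z ∈ Lᗮ → ⟪y - y', u⟫ = ⟪y - y', z⟫ := fun u z h => by
    have := (Submodule.mem_orthogonal L _).1 h _ hyy
    rw [inner_sub_right] at this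
    linarith
  -- The functional is constant on cosets of `Lᗮ`, and by monotonicity its values on the hull of `S`
  -- dominate those on the hull of `S'`. Near `x` every coset meets the hull of `S`, while that of
  -- `x` also meets the hull of `S'`. A linear functional with a local minimum vanishes.
  have hmin : IsLocalMin (fun z : E d => ⟪y - y', z⟫) x := by
    filter_upwards [mem_interior_iff_mem_nhds.1 hx] with z hz
    obtain ⟨u, hu, huz⟩ := hz
    rw [← hconst u z huz, ← hconst u' x hux']
    refine le_inner_of_mem_convexHull (fun a ha => ?_) hu
    refine inner_le_of_mem_convexHull (fun b hb => ?_) hu'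
    have := inner_sub_nonneg_of_mem_generators (hy.symm ▸ ha) (hy'.symm ▸ hb)
    rw [inner_sub_right] at this
    linarith
  have hz := hmin.hasFDerivAt_eq_zero (innerSL ℝ (y - y')).hasFDerivAt
  have : y = y' := by
    rw [← sub_eq_zero, ← inner_self_eq_zero (𝕜 := ℝ)]
    exact congrArg (fun f : E d →L[ℝ] ℝ => f (y - y')) hz
  rw [← hy, ← hy', this]

/-! ## Measurability and almost everywhere disjointness of tiles -/

instance (d p : ℕ) : SecondCountableTopology (Gr d p) :=
  Topology.IsInducing.secondCountableTopology ⟨rfl⟩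

theorem Gr.continuous_proj : Continuous (Gr.proj : Gr d p → E d →L[ℝ] E d) :=
  continuous_induced_dom

/-- Projection along the compact factor `C` is a closed map. -/
theorem isClosed_thicken_orthogonal {C : Set (E d)} (hC : IsCompact C) :
    IsClosed {q : E d × Gr d p | q.1 ∈ thicken C q.2.1ᗮ} := by
  have : CompactSpace C := isCompact_iff_compactSpace.1 hC
  have hcl : IsClosed {z : C × (E d × Gr d p) | z.2.2.proj (z.1 - z.2.1) = 0} := by
    refine isClosed_eq ?_ continuous_const
    exact (Gr.continuous_proj.comp (by fun_prop)).clm_apply (by fun_prop)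
  convert isClosedMap_snd_of_compactSpace _ hcl using 1
  ext q
  simp only [thicken, mem_ofPred_eq, mem_image, Prod.exists, exists_eq_right]
  constructor
  · rintro ⟨u, hu, h⟩
    exact ⟨⟨u, hu⟩, (Submodule.starProjection_apply_eq_zero_iff _).2 h⟩
  · rintro ⟨u, h⟩
    exact ⟨u, u.2, (Submodule.starProjection_apply_eq_zero_iff _).1 h⟩

theorem isClosed_thicken {C : Set (E d)} (hC : IsCompact C) :
    IsClosed {q : E d × Gr d p | q.1 ∈ thicken C q.2.1} := by
  have : CompactSpace C := isCompact_iff_compactSpace.1 hC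
  have hcl : IsClosed {z : C × (E d × Gr d p) | z.2.2.proj (z.1 - z.2.1) = z.1 - z.2.1} := by
    refine isClosed_eq ?_ (by fun_prop)
    exact (Gr.continuous_proj.comp (by fun_prop)).clm_apply (by fun_prop)
  convert isClosedMap_snd_of_compactSpace _ hcl using 1
  ext q
  simp only [thicken, mem_ofPred_eq, mem_image, Prod.exists, exists_eq_right]
  constructor
  · rintro ⟨u, hu, h⟩
    exact ⟨⟨u, hu⟩, Submodule.starProjection_eq_self_iff.2 h⟩
  · rintro ⟨u, h⟩
    exact ⟨u, u.2, Submodule.starProjection_eq_self_iff.1 h⟩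

theorem measurableSet_tile {γ γ' : Set (E d)} (hγ : IsCompact γ) (hγ' : IsClosed γ') :
    MeasurableSet (tile p γ γ') := by
  -- Voronoi cells may be unbounded, so `γ'` is exhausted by compact pieces.
  have h : tile p γ γ' = {q : E d × Gr d p | q.1 ∈ thicken γ q.2.1ᗮ} ∩
      ⋃ n : ℕ, {q : E d × Gr d p | q.1 ∈ thicken (γ' ∩ Metric.closedBall 0 n) q.2.1} := by
    ext ⟨x, L⟩
    rw [mem_tile_iff]
    refine and_congr Iff.rfl ?_
    rw [mem_iUnion]
    constructor
    · rintro ⟨y, hy, h⟩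
      obtain ⟨n, hn⟩ := exists_nat_ge ‖y‖
      exact ⟨n, y, ⟨hy, by simpa using hn⟩, h⟩
    · rintro ⟨n, y, ⟨hy, -⟩, h⟩
      exact ⟨y, hy, h⟩
  rw [h]
  exact (isClosed_thicken_orthogonal hγ).measurableSet.inter <| .iUnion fun n =>
    (isClosed_thicken ((isCompact_closedBall _ _).inter_left hγ')).measurableSet

theorem IsDelaunay.measurableSet_tile (hA : LocallyFiniteSet A) (hS : IsDelaunay A S) :
    MeasurableSet (delaunayTile p A S) :=
  VoronoiScape.measurableSet_tile ((hS.finite hA).isCompact_convexHull ℝ)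
    (isClosed_voronoiCell A S)

/-- By Fubini it suffices to fix `L`. There the overlap lies in frontiers of convex sets, since
`eq_of_mem_interior` excludes any other common point. -/
theorem aedisjoint_tile (hA : LocallyFiniteSet A) (ν : Measure (Gr d p)) [SFinite ν]
    {S' : Set (E d)} (hS : IsDelaunay A S) (hS' : IsDelaunay A S') (hne : S ≠ S') :
    AEDisjoint ((volume : Measure (E d)).prod ν) (delaunayTile p A S) (delaunayTile p A S') := by
  rw [AEDisjoint, Measure.prod_apply_symm
    ((hS.measurableSet_tile hA).inter (hS'.measurableSet_tile hA)), lintegral_eq_zero_of_ae_eq_zero]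
  refine Eventually.of_forall fun L => ?_
  have hfr : ∀ {C : Set (E d)} (M : Submodule ℝ (E d)), Convex ℝ C →
      volume (frontier (thicken C M)) = 0 := fun M hC =>
    (convex_thicken hC M).addHaar_frontier volume
  refine measure_mono_null (t := frontier (thicken (delaunayCell S) L.1ᗮ) ∪
    (frontier (thicken (voronoiCell A S) L.1) ∪ frontier (thicken (voronoiCell A S') L.1))) ?_
    (measure_union_null (hfr _ (convex_convexHull ℝ S)) (measure_union_null
      (hfr _ (convex_voronoiCell A S)) (hfr _ (convex_voronoiCell A S'))))
  rintro x ⟨hx, hx'⟩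
  obtain ⟨h1, h2⟩ := mem_tile_iff.1 hx
  obtain ⟨h3, h4⟩ := mem_tile_iff.1 hx'
  by_contra hcon
  simp only [mem_union, not_or] at hcon
  have key : ∀ {T : Set (E d)}, x ∈ T → x ∉ frontier T → x ∈ interior T := fun hT hT' => by
    by_contra h
    exact hT' ⟨subset_closure hT, h⟩
  exact hne (eq_of_mem_interior hS hS' (key h1 hcon.1) (key h2 hcon.2.1) h3 (key h4 hcon.2.2))

/-! ## Density conditions -/

theorem exists_mem_voronoiDomain (hA : LocallyFiniteSet A) (hne : A.Nonempty) (x : E d) :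
    ∃ a ∈ A, x ∈ voronoiDomain A a := by
  obtain ⟨a₀, h₀⟩ := hne
  obtain ⟨a, ha, hmin⟩ := Set.exists_min_image (A ∩ Metric.closedBall x (dist x a₀)) (dist x)
    (hA _ Metric.isBounded_closedBall) ⟨a₀, h₀, by rw [Metric.mem_closedBall, dist_comm]⟩
  refine ⟨a, ha.1, fun b hb => ?_⟩
  rcases le_total (dist x b) (dist x a₀) with h | h
  · exact hmin b ⟨hb, by rwa [Metric.mem_closedBall, dist_comm]⟩
  · exact (hmin a₀ ⟨h₀, by rw [Metric.mem_closedBall, dist_comm]⟩).trans h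

/-- An unbounded domain has a limiting direction `v`, and the bisector inequalities divided by `‖x
n‖` put `A` in the half-space `⟪v, ·⟫ ≤ ⟪v, a⟫`. Its hull then misses `a + v`. -/
theorem isBounded_voronoiDomain (hconv : convexHull ℝ A = univ) (a : E d) :
    Bornology.IsBounded (voronoiDomain A a) := by
  by_contra hb
  have hfar : ∀ n : ℕ, ∃ x ∈ voronoiDomain A a, (n : ℝ) + 1 < ‖x‖ := fun n => by
    by_contra! h
    exact hb (isBounded_iff_forall_norm_le.2 ⟨_, h⟩)
  choose x hx hxn using hfar
  have hpos : ∀ n, 0 < ‖x n‖ := fun n => lt_trans (by positivity) (hxn n)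
  obtain ⟨v, -, φ, hφ, hv⟩ := tendsto_subseq_of_bounded
    (Metric.isBounded_sphere (x := (0 : E d)) (r := 1)) (x := fun n => ‖x n‖⁻¹ • x n) fun n => by
      rw [mem_sphere_zero_iff_norm, norm_smul, norm_inv, norm_norm, inv_mul_cancel₀ (hpos n).ne']
  have hv1 : ‖v‖ = 1 := by
    refine tendsto_nhds_unique hv.norm (tendsto_const_nhds.congr fun n => ?_)
    simp [norm_smul, (hpos (φ n)).ne']
  have hle : ∀ b ∈ A, ⟪v, b⟫ ≤ ⟪v, a⟫ := fun b hbA => by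
    have h1 : Tendsto (fun n => ⟪b - a, ‖x (φ n)‖⁻¹ • x (φ n)⟫) atTop (𝓝 ⟪b - a, v⟫) :=
      tendsto_const_nhds.inner hv
    have h2 : Tendsto (fun n => (|‖b‖ ^ 2 - ‖a‖ ^ 2|) * ((φ n : ℝ) + 1)⁻¹) atTop (𝓝 0) := by
      rw [← mul_zero (|‖b‖ ^ 2 - ‖a‖ ^ 2|)]
      refine tendsto_const_nhds.mul (tendsto_inv_atTop_zero.comp ?_)
      exact tendsto_atTop_add_const_right _ _
        (tendsto_natCast_atTop_atTop.comp hφ.tendsto_atTop)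
    have h3 : ⟪b - a, v⟫ ≤ 0 := by
      refine le_of_tendsto_of_tendsto' h1 h2 fun n => ?_
      have h := (dist_le_dist_iff _ _ _).1 (hx (φ n) b hbA)
      have hn := hpos (φ n)
      rw [real_inner_smul_right, mul_comm]
      have h4 : ⟪b - a, x (φ n)⟫ ≤ |‖b‖ ^ 2 - ‖a‖ ^ 2| := by
        have := le_abs_self (‖b‖ ^ 2 - ‖a‖ ^ 2)
        have := abs_nonneg (‖b‖ ^ 2 - ‖a‖ ^ 2)
        linarith
      calc ⟪b - a, x (φ n)⟫ * ‖x (φ n)‖⁻¹ ≤ |‖b‖ ^ 2 - ‖a‖ ^ 2| * ‖x (φ n)‖⁻¹ := by gcongr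
        _ ≤ _ := by
          gcongr
          exact (hxn (φ n)).le
    rw [real_inner_comm, inner_sub_right] at h3
    linarith
  have := inner_le_of_mem_convexHull hle (hconv ▸ mem_univ (a + v))
  rw [inner_add_right, real_inner_self_eq_norm_sq, hv1] at this
  linarith

/-- The generators of a farthest point of a compact Voronoi domain span the whole space. -/
theorem cellDim_generators_of_isMaxOn (hA : LocallyFiniteSet A) {a e : E d} (ha : a ∈ A)
    (he : e ∈ voronoiDomain A a) (hmax : IsMaxOn (fun x => dist x a) (voronoiDomain A a) e) :
    cellDim (generators A e) = d := by
  set S := generators A e with hS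
  have haS : a ∈ S := ⟨ha, he⟩
  have hle : cellDim S ≤ d := by
    simpa [cellDim] using Submodule.finrank_le (vectorSpan ℝ S)
  by_contra hdim
  have htop : vectorSpan ℝ S ≠ ⊤ := fun h => hdim (by rw [cellDim, h]; simp)
  -- If the span is proper, moving `e` along a normal `w` in either direction keeps it in the domain
  -- for a short while, and one of the two directions increases the distance to `a`.
  obtain ⟨w, hw, hw0⟩ := Submodule.exists_mem_ne_zero_of_ne_bot
    (mt Submodule.orthogonal_eq_bot_iff.1 htop)
  have hwS : ∀ b ∈ S, ⟪b - a, w⟫ = 0 := fun b hb =>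
    (Submodule.mem_orthogonal _ _).1 hw _ (vsub_mem_vectorSpan ℝ hb haS)
  have hev : ∀ᶠ t : ℝ in 𝓝 0, e + t • w ∈ voronoiDomain A a := by
    -- After a displacement below `1 / 2`, points of `A` farther than `dist e a + 1` from `e` still
    -- cannot beat `a`, so only finitely many competitors remain.
    have hball : ∀ᶠ t : ℝ in 𝓝 0, dist (e + t • w) e < 1 / 2 := by
      have : Tendsto (fun t : ℝ => dist (e + t • w) e) (𝓝 0) (𝓝 (dist (e + (0 : ℝ) • w) e)) :=
        (by fun_prop : Continuous fun t : ℝ => dist (e + t • w) e).tendsto 0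
      rw [zero_smul, add_zero, dist_self] at this
      exact this.eventually_lt_const (by norm_num)
    have hfin : ∀ᶠ t : ℝ in 𝓝 0, ∀ b ∈ A ∩ Metric.closedBall e (dist e a + 1),
        dist (e + t • w) a ≤ dist (e + t • w) b := by
      refine (Filter.eventually_all_finite (hA _ Metric.isBounded_closedBall)).2 fun b hb => ?_
      by_cases hbS : b ∈ S
      · refine Eventually.of_forall fun t => ?_
        rw [dist_le_dist_iff, inner_add_right, real_inner_smul_right, hwS b hbS, mul_zero,
          add_zero, ← dist_le_dist_iff]
        exact he b hb.1
      · have hlt := dist_lt_of_notMem_generators haS hb.1 hbS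
        have h1 : Continuous fun t : ℝ => dist (e + t • w) a := by fun_prop
        have h2 : Continuous fun t : ℝ => dist (e + t • w) b := by fun_prop
        refine ((h1.tendsto 0).eventually_lt (h2.tendsto 0) ?_).mono fun _ => le_of_lt
        simpa using hlt
    filter_upwards [hball, hfin] with t ht1 ht2 b hb
    by_cases hbb : b ∈ Metric.closedBall e (dist e a + 1)
    · exact ht2 b ⟨hb, hbb⟩
    · rw [Metric.mem_closedBall, not_le, dist_comm b e] at hbb
      have h1 := dist_triangle (e + t • w) e a
      have h2 := dist_triangle e (e + t • w) b
      rw [dist_comm e (e + t • w)] at h2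
      linarith
  have hneg : ∀ᶠ t : ℝ in 𝓝 0, e + (-t) • w ∈ voronoiDomain A a := by
    have : Tendsto (fun t : ℝ => -t) (𝓝 0) (𝓝 0) := by
      simpa using (continuous_neg (G := ℝ)).tendsto 0
    exact this.eventually hev
  obtain ⟨t, ⟨h1, h2⟩, ht⟩ := (((hev.and hneg).filter_mono nhdsWithin_le_nhds).and
    (self_mem_nhdsWithin (s := Ioi (0 : ℝ)))).exists
  have ht0 : 0 < t := ht
  have h1' := hmax h1
  have h2' := hmax h2
  simp only [mem_ofPred_eq, dist_eq_norm] at h1' h2'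
  have e1 : e + t • w - a = (e - a) + t • w := by module
  have e2 : e + (-t) • w - a = (e - a) - t • w := by module
  rw [e1] at h1'
  rw [e2] at h2'
  have hpar := parallelogram_law_with_norm ℝ (e - a) (t • w)
  have hpos : 0 < ‖t • w‖ := norm_pos_iff.2 (smul_ne_zero ht0.ne' hw0)
  nlinarith [norm_nonneg (e - a + t • w), norm_nonneg (e - a - t • w)]

theorem uniformlyDense_of_boundedCircumradii (hA : LocallyFiniteSet A)
    (hconv : convexHull ℝ A = univ) (hC : BoundedCircumradii A) : UniformlyDense A := by
  obtain ⟨C, hC⟩ := hC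
  have hne : A.Nonempty := by
    rw [← convexHull_nonempty_iff (𝕜 := ℝ), hconv]
    exact univ_nonempty
  refine ⟨C, fun r hr _ c => ?_⟩
  obtain ⟨a, ha, hca⟩ := exists_mem_voronoiDomain hA hne c
  have hcomp : IsCompact (voronoiDomain A a) :=
    Metric.isCompact_of_isClosed_isBounded (isClosed_voronoiDomain A a)
      (isBounded_voronoiDomain hconv a)
  obtain ⟨e, he, hmax⟩ := hcomp.exists_isMaxOn ⟨c, hca⟩
    (f := fun x => dist x a) (by fun_prop)
  refine ⟨a, ?_, ha⟩
  rw [Metric.mem_closedBall, dist_comm]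
  have h1 : dist c a ≤ dist e a := hmax hca
  have h2 : dist e a ≤ C := by
    refine hC (generators A e) ⟨⟨a, ha, he⟩, e, rfl⟩ (cellDim_generators_of_isMaxOn hA ha he hmax)
      e _ fun b hb => ?_
    rw [dist_comm]
    exact le_antisymm (hb.2 a ha) (he b hb.1)
  linarith

theorem UniformlyDense.sublinearlyDense (h : UniformlyDense A) : SublinearlyDense A := by
  obtain ⟨R₀, h⟩ := h
  have hpos : 0 < |R₀| + 1 := by positivity
  exact ⟨fun _ => |R₀| + 1, Asymptotics.isLittleO_const_id_atTop _, Eventually.of_forall fun R =>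
    ⟨hpos.le, fun c _ => h _ (by linarith [le_abs_self R₀]) hpos c⟩⟩

/-! ## The boundary layer -/

/-- The radius of an empty ball that reaches into `B(R)` is controlled by the density in `B(2R)`. -/
theorem le_of_empty_ball {R G r : ℝ} (hGR : G < R) (hG : 0 ≤ G)
    (hdense : ∀ c : E d, (Metric.closedBall c G ∩ Metric.closedBall 0 (2 * R)).Nonempty →
      (Metric.closedBall c G ∩ A).Nonempty) {y z : E d} (hempty : ∀ a ∈ A, r ≤ dist y a)
    (hzy : dist z y ≤ r) (hz : ‖z‖ ≤ R) : r ≤ G := by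
  by_contra! hr
  -- The ball of radius `G` about a centre at distance at most `r - G'` from `y` is strictly inside
  -- the empty ball because `G < G'`. The bound `G' < R` keeps that centre in `B(2R)`.
  obtain ⟨G', h1, h2⟩ := exists_between (lt_min hr hGR)
  obtain ⟨h2, h3⟩ := lt_min_iff.1 h2
  have hr0 : 0 < r := hG.trans_lt hr
  have hs0 : 0 ≤ G' / r := div_nonneg (hG.trans h1.le) hr0.le
  have hs1 : 0 ≤ 1 - G' / r := by rw [sub_nonneg, div_le_one hr0]; exact h2.le
  set c := z + (G' / r) • (y - z) with hc
  have hcz : ‖c - z‖ ≤ G' := by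
    rw [hc, add_sub_cancel_left, norm_smul, Real.norm_of_nonneg hs0]
    rw [dist_comm, dist_eq_norm] at hzy
    calc G' / r * ‖y - z‖ ≤ G' / r * r := by gcongr
      _ = G' := by field_simp
  have hcy : dist c y ≤ r - G' := by
    have : c - y = (1 - G' / r) • (z - y) := by rw [hc]; module
    rw [dist_eq_norm, this, norm_smul, Real.norm_of_nonneg hs1]
    rw [dist_eq_norm] at hzy
    calc (1 - G' / r) * ‖z - y‖ ≤ (1 - G' / r) * r := by gcongr
      _ = r - G' := by field_simp
  have hcn : ‖c‖ ≤ 2 * R := by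
    have := norm_le_norm_add_norm_sub' c z
    linarith
  obtain ⟨a, hac, ha⟩ := hdense c ⟨c, Metric.mem_closedBall_self hG, by simpa using hcn⟩
  rw [Metric.mem_closedBall] at hac
  have h4 := hempty a ha
  have h5 := dist_triangle a c y
  rw [dist_comm a y] at h5
  linarith

theorem dist_le_of_mem_orthogonal {L : Submodule ℝ (E d)} {x y u : E d} (hu : u - x ∈ Lᗮ)
    (hy : y - x ∈ L) : dist x u ≤ dist u y ∧ dist x y ≤ dist u y := by
  have h := (Submodule.mem_orthogonal L _).1 hu _ hy
  have h1 : ‖u - y‖ ^ 2 = ‖u - x‖ ^ 2 + ‖y - x‖ ^ 2 := by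
    rw [← sub_sub_sub_cancel_right u y x, norm_sub_sq_real, real_inner_comm, h]
    ring
  rw [dist_comm x u, dist_comm x y, dist_eq_norm, dist_eq_norm, dist_eq_norm]
  constructor <;> refine (sq_le_sq₀ (norm_nonneg _) (norm_nonneg _)).1 ?_ <;>
    nlinarith [sq_nonneg ‖u - x‖, sq_nonneg ‖y - x‖]

/-- The vertex-hull point `u'` of the second tile point links the two: it is within `2G` of `q.1`
through `y`, and within `G` of `q'.1` through `y'`. The second radius bound needs `‖u'‖ ≤ 2R`, hence
density in `B(4R)`. -/
theorem dist_le_of_mem_tile {R G : ℝ} (hGR : 2 * G < R) (hG : 0 ≤ G)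
    (hdense : ∀ c : E d, (Metric.closedBall c G ∩ Metric.closedBall 0 (4 * R)).Nonempty →
      (Metric.closedBall c G ∩ A).Nonempty) (hS : IsDelaunay A S)
    {q q' : E d × Gr d p} (hq : q ∈ delaunayTile p A S) (hq' : q' ∈ delaunayTile p A S)
    (hqR : ‖q.1‖ ≤ R) : dist q'.1 q.1 ≤ 3 * G := by
  obtain ⟨⟨u, hu, hux⟩, y, hy, hyx⟩ := mem_tile_iff.1 hq
  obtain ⟨⟨u', hu', hux'⟩, y', hy', hyx'⟩ := mem_tile_iff.1 hq'
  obtain ⟨a, ha⟩ := hS.1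
  have haA := hS.subset ha
  have hrad : ∀ {z v : E d}, v ∈ voronoiCell A S → dist z v ≤ dist v a → ‖z‖ ≤ 2 * R →
      dist v a ≤ G := fun hv hzv hz =>
    le_of_empty_ball (by linarith) hG (by ring_nf at hdense ⊢; exact hdense)
      (fun b hb => dist_le_of_mem_voronoiCell hv ha hb) hzv hz
  obtain ⟨-, h2⟩ := dist_le_of_mem_orthogonal hux hyx
  obtain ⟨h1', -⟩ := dist_le_of_mem_orthogonal hux' hyx'
  have h3 := dist_le_of_mem_delaunayCell hy hu haA
  have h4 := dist_le_of_mem_delaunayCell hy hu' haA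
  have h5 := dist_le_of_mem_delaunayCell hy' hu' haA
  have hr := hrad hy (h2.trans h3) (by linarith)
  have h6 : dist u' q.1 ≤ 2 * G := by
    have := dist_triangle_right u' q.1 y
    linarith
  have h7 : ‖u'‖ ≤ 2 * R := by
    have := norm_le_norm_add_norm_sub' u' q.1
    rw [← dist_eq_norm] at this
    linarith
  have hr' := hrad hy' h5 h7
  have := dist_triangle q'.1 u' q.1
  linarith

/-- All points are within `3G` of the inner witness `q₁`, hence within `6G` of the outer witness
`q₂`. -/
theorem boundaryTile_subset {R G : ℝ} (hGR : 2 * G < R) (hG : 0 ≤ G)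
    (hdense : ∀ c : E d, (Metric.closedBall c G ∩ Metric.closedBall 0 (4 * R)).Nonempty →
      (Metric.closedBall c G ∩ A).Nonempty) (hS : S ∈ boundaryCells p A R) :
    delaunayTile p A S ⊆ (Metric.closedBall (0 : E d) (R + 6 * G) \
      Metric.closedBall 0 (R - 6 * G)) ×ˢ (univ : Set (Gr d p)) := by
  obtain ⟨hD, -, ⟨q₁, hq₁, h1⟩, q₂, hq₂, h2⟩ := hS
  rw [mem_closedBall_zero_iff] at h1 h2
  intro q hq
  have h3 := dist_le_of_mem_tile hGR hG hdense hD hq₁ hq h1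
  have h4 := dist_le_of_mem_tile hGR hG hdense hD hq₁ hq₂ h1
  have h5 := norm_le_norm_add_norm_sub' q.1 q₁.1
  have h6 := norm_le_norm_add_norm_sub' q₂.1 q.1
  have h7 := dist_triangle_right q₂.1 q.1 q₁.1
  rw [← dist_eq_norm] at h5 h6
  refine ⟨⟨?_, ?_⟩, mem_univ _⟩
  · rw [mem_closedBall_zero_iff]
    linarith
  · rw [mem_closedBall_zero_iff]
    linarith

/-! ### Summing tiles and the volume of the shell -/

theorem volume_annulus {s t : ℝ} (hs : 0 ≤ s) (hst : s ≤ t) :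
    volume (Metric.closedBall (0 : E d) t \ Metric.closedBall 0 s) =
      ENNReal.ofReal ((t ^ d - s ^ d) * volume.real (Metric.ball (0 : E d) 1)) := by
  rw [measure_sdiff (Metric.closedBall_subset_closedBall hst)
    measurableSet_closedBall.nullMeasurableSet measure_closedBall_lt_top.ne,
    Measure.addHaar_closedBall _ _ hs, Measure.addHaar_closedBall _ _ (hs.trans hst),
    finrank_euclideanSpace_fin, ← ofReal_measureReal (measure_ball_lt_top.ne), sub_mul,
    ENNReal.ofReal_sub _ (mul_nonneg (pow_nonneg hs d) measureReal_nonneg),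
    ENNReal.ofReal_mul (pow_nonneg (hs.trans hst) d), ENNReal.ofReal_mul (pow_nonneg hs d)]

theorem boundaryMeasure_le (hA : LocallyFiniteSet A) (hp : p ≤ d) {R : ℝ}
    {Ω : Set (E d)} (h : ∀ S ∈ boundaryCells p A R, delaunayTile p A S ⊆ Ω ×ˢ univ) :
    boundaryMeasure hp A R ≤ volume Ω := by
  have hdisj : Pairwise (Function.onFun (AEDisjoint ((volume : Measure (E d)).prod (uniformGr hp)))
      fun S : boundaryCells p A R => delaunayTile p A S.1) := fun S S' hne =>
    aedisjoint_tile hA _ S.2.1 S'.2.1 (Subtype.coe_injective.ne hne)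
  calc boundaryMeasure hp A R
      ≤ ((volume : Measure (E d)).prod (uniformGr hp))
          (⋃ S : boundaryCells p A R, delaunayTile p A S.1) :=
        tsum_meas_le_meas_iUnion_of_disjoint₀ _
          (fun S => (S.2.1.measurableSet_tile hA).nullMeasurableSet) hdisj
    _ ≤ ((volume : Measure (E d)).prod (uniformGr hp)) (Ω ×ˢ univ) :=
        measure_mono (iUnion_subset fun S => h S.1 S.2)
    _ = volume Ω := by rw [Measure.prod_prod, measure_univ, mul_one]

theorem SublinearlyDense.mixedRegularity (hA : LocallyFiniteSet A) (h : SublinearlyDense A) :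
    MixedRegularity A := by
  intro p hp ε hε
  obtain ⟨g, hg, hdense⟩ := h
  have hη : ∀ᶠ η : ℝ in 𝓝 0,
      ((1 + 6 * η) ^ d - (1 - 6 * η) ^ d) * volume.real (Metric.ball (0 : E d) 1) < ε := by
    have hc : Continuous fun η : ℝ =>
        ((1 + 6 * η) ^ d - (1 - 6 * η) ^ d) * volume.real (Metric.ball (0 : E d) 1) := by fun_prop
    exact (hc.tendsto 0).eventually_lt_const (by simpa using hε)
  -- The shell's relative volume tends to zero with `η`; `η < 1 / 6` keeps its inner radius
  -- positive.
  obtain ⟨η, ⟨hηε, hη6⟩, hη0⟩ := (((hη.and (gt_mem_nhds (show (0 : ℝ) < 1 / 6 by norm_num))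
    ).filter_mono nhdsWithin_le_nhds).and (self_mem_nhdsWithin (s := Ioi (0 : ℝ)))).exists
  have hη0 : 0 < η := hη0
  have h4 : Tendsto (fun R : ℝ => 4 * R) atTop atTop := tendsto_id.const_mul_atTop four_pos
  -- The factor `η / 4` offsets the argument `4 * R`, giving `g (4 * R) ≤ η * R`.
  filter_upwards [h4.eventually hdense, h4.eventually (hg.bound (show 0 < η / 4 by positivity)),
    eventually_gt_atTop 0] with R hR hgR hR0
  obtain ⟨hG, hdense⟩ := hR
  rw [Real.norm_of_nonneg hG, Real.norm_of_nonneg (by positivity)] at hgR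
  have hgη : g (4 * R) ≤ η * R := by linarith
  have hηR : 6 * (η * R) < R := by nlinarith
  refine (boundaryMeasure_le hA hp fun S hS =>
    boundaryTile_subset (by linarith) hG hdense hS).trans ?_
  rw [volume_annulus (by linarith) (by linarith)]
  refine ENNReal.ofReal_le_ofReal ?_
  calc ((R + 6 * g (4 * R)) ^ d - (R - 6 * g (4 * R)) ^ d) * volume.real (Metric.ball (0 : E d) 1)
      ≤ (((1 + 6 * η) * R) ^ d - ((1 - 6 * η) * R) ^ d) *
          volume.real (Metric.ball (0 : E d) 1) := by
        gcongr
        · linarith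
        · nlinarith
        · linarith
    _ = ((1 + 6 * η) ^ d - (1 - 6 * η) ^ d) * volume.real (Metric.ball (0 : E d) 1) * R ^ d := by
        rw [mul_pow, mul_pow]
        ring
    _ ≤ ε * R ^ d := by gcongr

end VoronoiScape

end

theorem lemma5 (d : ℕ) (A : Set (VoronoiScape.E d)) (hA : VoronoiScape.LocallyFiniteSet A)
    (h : (convexHull ℝ A = Set.univ ∧ VoronoiScape.BoundedCircumradii A) ∨
      VoronoiScape.UniformlyDense A ∨
      VoronoiScape.SublinearlyDense A) :
    VoronoiScape.MixedRegularity A := by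
  obtain ⟨hconv, hC⟩ | h | h := h
  · exact (VoronoiScape.uniformlyDense_of_boundedCircumradii hA hconv
      hC).sublinearlyDense.mixedRegularity hA
  · exact h.sublinearlyDense.mixedRegularity hA
  · exact h.mixedRegularity hA
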